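/- Let $\mu$ be a positive Borel measure on $\mathbb{R}$ with $\int e^{\delta|x|}\,d\mu(x)<\infty$ for some $\delta>0$ (so that $\mu$ is determined by its moments), and let $\mathcal{M}$ be a closed subset of $\operatorname{supp}\mu$. Let $(p_n)_{n\ge 0}$ be real polynomials, $\deg p_n=n$, with $\int p_np_m\,d\mu=\hat p_n\delta_{nm}$ and $\hat p_n\neq 0$ for all $n$, and let $(c_n)_{n\ge 0}$ be real numbers with $$\sum_{n\ge 0}c_n^2\,\hat p_n\log^2(n+1)<\infty .$$ Then the series $\sum_{n\ge 0}c_np_n$ converges in $L^2(\mu)$. Its sum $f$ is nonnegative $\mu$-a.e. and vanishes $\mu$-a.e. outside $\mathcal{M}$ if and only if $f=\frac{d\nu}{d\mu}$ for some finite positive measure $\nu\ll\mu$ supported on $\mathcal{M}$ (that is, $\nu(\mathbb{R}\setminus\mathcal{M})=0$). Moreover, let $\nu$ be any finite positive Borel measure supported on $\mathcal{M}$. Then $\nu\ll\mu$ and $f=\frac{d\nu}{d\mu}$ if and only if, for all $n\ge 0$, $p_n$ is $\nu$-integrable and $$c_n=\frac{1}{\hat p_n}\int_{\mathcal{M}}p_n\,d\nu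 .$$ Call real polynomials $(r_n)_{n\ge 0}$ with $\deg r_n=n$ orthogonal with respect to $\nu$ if $\nu$ has finite moments of all orders and $\int r_nr_m\,d\nu=0$ for $n\ne m$ (the values $\int r_n^2\,d\nu$ may be zero). If $(r_n)$ are orthogonal with respect to $\nu$, normalized by $\int r_0\,d\nu=1$, and $p_n=\sum_{j=0}^n\gamma_{n,j}r_j$ for all $n$, then $\nu\ll\mu$ and $f=\frac{d\nu}{d\mu}$ if and only if $c_n=\gamma_{n,0}/\hat p_n$ for all $n\ge 0$. If $\nu\neq 0$, $\nu\ll\mu$ and $f=\frac{d\nu}{d\mu}$, then such $(r_n)$ and $(\gamma_{n,j})$ exist. -/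

import Mathlib

open MeasureTheory Filter Topology Polynomial

noncomputable section

/-- The exponential moment condition: `∫ exp (δ |x|) dμ < ∞` for some `δ > 0`.
In particular `μ` is finite and has moments of all orders. -/
def HasExpMoment (μ : Measure ℝ) : Prop :=
  ∃ δ : ℝ, 0 < δ ∧ Integrable (fun x : ℝ => Real.exp (δ * |x|)) μ

/-- `p` is a sequence of polynomials, `p n` of exact degree `n`, pairwise orthogonal with respect
to `μ`, whose moments are all finite. The squared norms are allowed to vanish here, so that the
notion makes sense for a finitely supported `μ` too. -/
structure IsOrthogonalPolynomials (μ : Measure ℝ) (p : ℕ → ℝ[X]) : Prop where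
  moments : ∀ k : ℕ, Integrable (fun x : ℝ => x ^ k) μ
  degree_eq : ∀ n : ℕ, (p n).degree = (n : WithBot ℕ)
  orthogonal : ∀ m n : ℕ, m ≠ n → ∫ x, (p m).eval x * (p n).eval x ∂μ = 0

/-- The squared norm `p̂ₙ = ∫ pₙ² dμ`. -/
def hatNorm (μ : Measure ℝ) (p : ℕ → ℝ[X]) (n : ℕ) : ℝ :=
  ∫ x, (p n).eval x ^ 2 ∂μ

/-- The series `∑ cₙ pₙ(x)` converges in mean square (in `L²(μ)`) to the function `f`. -/
def HasMeanSquareSum (μ : Measure ℝ) (p : ℕ → ℝ[X]) (c : ℕ → ℝ) (f : ℝ → ℝ) : Prop :=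
  MemLp f 2 μ ∧
    Tendsto (fun N : ℕ =>
      eLpNorm (fun x : ℝ => (∑ n ∈ Finset.range N, c n * (p n).eval x) - f x) 2 μ)
      atTop (𝓝 0)

/-- `f` is (a version of) the Radon-Nikodym derivative `dν/dμ`. -/
def IsRadonNikodymDeriv (f : ℝ → ℝ) (ν μ : Measure ℝ) : Prop :=
  ν ≪ μ ∧ f =ᵐ[μ] fun x => (ν.rnDeriv μ x).toReal

/-- `γ n j` (`j ≤ n`) are the connection coefficients of `p` in terms of `r`:
`pₙ = ∑_{j ≤ n} γ_{n,j} r_j`. -/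
def IsConnection (p r : ℕ → ℝ[X]) (γ : ℕ → ℕ → ℝ) : Prop :=
  ∀ n : ℕ, p n = ∑ j ∈ Finset.range (n + 1), C (γ n j) * r j

end

/-! The `L²` sum `f` has the `c n` as its Fourier coefficients, so the coefficient formula says that
`ν` and the possibly signed measure `f μ` integrate every `p n`, hence every polynomial, alike. The
core is therefore a determinacy statement, `HasExpMoment.isRadonNikodymDeriv_iff`.

Since nothing is known about the sign of `f`, its negative part is moved to the other side: `ν + f⁻
μ` and `f⁺ μ` are positive measures with equal moments. Both have exponential moments: `f⁺ μ` and
`f⁻ μ` by Cauchy–Schwarz, and `ν` because its even moments are at most those of `|f| μ`. By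
`HasExpMoment.ext` the two measures coincide, which gives `ν ≪ μ` and the density at once.

The version with connection coefficients follows because orthogonality to the constant `r 0` leaves
only `γ n 0` in `∫ p n dν`. -/

/-! ### Exponential moments and determinacy. -/

theorem HasExpMoment.isFiniteMeasure {μ : Measure ℝ} (h : HasExpMoment μ) : IsFiniteMeasure μ := by
  obtain ⟨δ, hδ, hi⟩ := h
  have h1 : Integrable (fun _ : ℝ => (1 : ℝ)) μ := by
    refine hi.mono' aestronglyMeasurable_const (Eventually.of_forall fun x => ?_)
    simpa using Real.one_le_exp (by positivity)
  rw [integrable_const_iff] at h1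
  exact h1.resolve_left one_ne_zero

theorem HasExpMoment.exists_Ioo_subset {μ : Measure ℝ} (h : HasExpMoment μ) :
    ∃ δ : ℝ, 0 < δ ∧ Set.Ioo (-δ) δ ⊆ interior (ProbabilityTheory.integrableExpSet id μ) := by
  obtain ⟨δ, hδ, hi⟩ := h
  refine ⟨δ, hδ, interior_maximal (fun t ht => ?_) isOpen_Ioo⟩
  refine hi.mono' (by fun_prop) (Eventually.of_forall fun x => ?_)
  rw [Real.norm_eq_abs, Real.abs_exp, id, Real.exp_le_exp]
  refine (le_abs_self _).trans ?_
  rw [abs_mul]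
  exact mul_le_mul_of_nonneg_right (abs_lt.2 ht).le (abs_nonneg x)

theorem HasExpMoment.zero_mem_interior {μ : Measure ℝ} (h : HasExpMoment μ) :
    0 ∈ interior (ProbabilityTheory.integrableExpSet id μ) := by
  obtain ⟨δ, hδ, hs⟩ := h.exists_Ioo_subset
  exact hs ⟨neg_lt_zero.2 hδ, hδ⟩

theorem HasExpMoment.integrable_pow {μ : Measure ℝ} (h : HasExpMoment μ) (n : ℕ) :
    Integrable (fun x : ℝ => x ^ n) μ := by
  simpa using ProbabilityTheory.integrable_pow_of_mem_interior_integrableExpSet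
    h.zero_mem_interior n

/-- The moment problem is determinate under an exponential moment condition. -/
theorem HasExpMoment.ext {μ ν : Measure ℝ} (hμ : HasExpMoment μ) (hν : HasExpMoment ν)
    (h : ∀ n : ℕ, ∫ x, x ^ n ∂μ = ∫ x, x ^ n ∂ν) : μ = ν := by
  have := hμ.isFiniteMeasure
  have := hν.isFiniteMeasure
  obtain ⟨a, ha, hsa⟩ := hμ.exists_Ioo_subset
  obtain ⟨b, hb, hsb⟩ := hν.exists_Ioo_subset
  set I : Set ℝ := Set.Ioo (-(min a b)) (min a b)
  have h0I : (0 : ℝ) ∈ I := ⟨neg_lt_zero.2 (lt_min ha hb), lt_min ha hb⟩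
  have hIa : I ⊆ interior (ProbabilityTheory.integrableExpSet id μ) :=
    (Set.Ioo_subset_Ioo (neg_le_neg (min_le_left _ _)) (min_le_left _ _)).trans hsa
  have hIb : I ⊆ interior (ProbabilityTheory.integrableExpSet id ν) :=
    (Set.Ioo_subset_Ioo (neg_le_neg (min_le_right _ _)) (min_le_right _ _)).trans hsb
  set S : Set ℂ := {z | z.re ∈ I}
  have hSμ : AnalyticOnNhd ℂ (ProbabilityTheory.complexMGF id μ) S :=
    fun z hz => ProbabilityTheory.analyticAt_complexMGF (hIa hz)
  have hSν : AnalyticOnNhd ℂ (ProbabilityTheory.complexMGF id ν) S :=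
    fun z hz => ProbabilityTheory.analyticAt_complexMGF (hIb hz)
  have hS : IsPreconnected S :=
    ((convex_Ioo _ _).linear_preimage Complex.reLm).isPreconnected
  have h0 : (0 : ℂ) ∈ S := by simpa [S] using h0I
  have hder : ∀ n : ℕ, iteratedDeriv n (ProbabilityTheory.complexMGF id μ) 0
      = iteratedDeriv n (ProbabilityTheory.complexMGF id ν) 0 := by
    intro n
    rw [ProbabilityTheory.iteratedDeriv_complexMGF (hIa h0),
      ProbabilityTheory.iteratedDeriv_complexMGF (hIb h0)]
    have := congrArg (fun r : ℝ => (r : ℂ)) (h n)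
    simp only [← integral_complex_ofReal] at this
    simpa using this
  -- The Taylor coefficients at `0` are the moments up to factorials, so the power series agree; the
  -- identity theorem then extends this to the whole vertical strip `S`.
  have hev : ProbabilityTheory.complexMGF id μ =ᶠ[𝓝 0] ProbabilityTheory.complexMGF id ν := by
    have h1 := (hSμ 0 h0).hasFPowerSeriesAt
    have h2 := (hSν 0 h0).hasFPowerSeriesAt
    simp only [hder] at h1
    have h3 := h1.sub h2
    rw [sub_self] at h3
    filter_upwards [h3.eventually_eq_zero] with z hz
    exact sub_eq_zero.1 hz
  have heq := hSμ.eqOn_of_preconnected_of_eventuallyEq hSν hS h0 hev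
  -- The imaginary axis lies in `S`, and there `complexMGF` is the characteristic function.
  refine Measure.ext_of_charFun (funext fun t => ?_)
  rw [← ProbabilityTheory.complexMGF_id_mul_I, ← ProbabilityTheory.complexMGF_id_mul_I]
  exact heq (by simpa [S] using h0I)

theorem HasExpMoment.add {μ ν : Measure ℝ} (hμ : HasExpMoment μ) (hν : HasExpMoment ν) :
    HasExpMoment (μ + ν) := by
  obtain ⟨a, ha, hia⟩ := hμ
  obtain ⟨b, hb, hib⟩ := hν
  refine ⟨min a b, lt_min ha hb, Integrable.add_measure ?_ ?_⟩
  · refine hia.mono' (by fun_prop) (Eventually.of_forall fun x => ?_)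
    rw [Real.norm_eq_abs, Real.abs_exp, Real.exp_le_exp]
    exact mul_le_mul_of_nonneg_right (min_le_left _ _) (abs_nonneg x)
  · refine hib.mono' (by fun_prop) (Eventually.of_forall fun x => ?_)
    rw [Real.norm_eq_abs, Real.abs_exp, Real.exp_le_exp]
    exact mul_le_mul_of_nonneg_right (min_le_right _ _) (abs_nonneg x)

/-- Cauchy–Schwarz at the price of halving `δ`: `exp (δ |x| / 2)` is in `L²(μ)`, as is `g`. -/
theorem HasExpMoment.withDensity_ofReal {μ : Measure ℝ} (hμ : HasExpMoment μ) {g : ℝ → ℝ}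
    (hg : MemLp g 2 μ) : HasExpMoment (μ.withDensity fun x => ENNReal.ofReal (g x)) := by
  obtain ⟨δ, hδ, hi⟩ := hμ
  refine ⟨δ / 2, by positivity, ?_⟩
  have hexp : MemLp (fun x : ℝ => Real.exp (δ / 2 * |x|)) 2 μ := by
    rw [memLp_two_iff_integrable_sq (by fun_prop)]
    refine hi.congr (Eventually.of_forall fun x => ?_)
    simp only [← Real.exp_nat_mul]
    congr 1
    push_cast
    ring
  have hint := hexp.integrable_mul hg
  rw [integrable_withDensity_iff_integrable_smul₀' (hg.aestronglyMeasurable.aemeasurable.ennreal_ofReal) (by simp)]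
  refine hint.mono ?_ (Eventually.of_forall fun x => ?_)
  · have := hg.aestronglyMeasurable.aemeasurable
    exact AEMeasurable.aestronglyMeasurable (by fun_prop)
  · simp only [smul_eq_mul, norm_mul, Pi.mul_apply]
    rw [mul_comm]
    gcongr
    rw [ENNReal.toReal_ofReal', Real.norm_eq_abs, Real.norm_eq_abs, abs_of_nonneg (le_max_right _ _)]
    exact max_le (le_abs_self _) (abs_nonneg _)

/-- The power series of `cosh` has only nonnegative terms, so Tonelli applies with no integrability
assumption. Only even moments enter, and these can be compared between measures. -/
theorem lintegral_ofReal_cosh (ν : Measure ℝ) (ε : ℝ) :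
    ∫⁻ x, ENNReal.ofReal (Real.cosh (ε * x)) ∂ν
      = ∑' k : ℕ, ENNReal.ofReal (ε ^ (2 * k) / (2 * k).factorial) *
          ∫⁻ x, ENNReal.ofReal (x ^ (2 * k)) ∂ν := by
  have hpt : ∀ x : ℝ, ENNReal.ofReal (Real.cosh (ε * x))
      = ∑' k : ℕ, ENNReal.ofReal (ε ^ (2 * k) / (2 * k).factorial) * ENNReal.ofReal (x ^ (2 * k)) := by
    intro x
    have h := Real.hasSum_cosh (ε * x)
    have hnn : ∀ (y : ℝ) (k : ℕ), 0 ≤ y ^ (2 * k) := fun y k => by rw [pow_mul]; positivity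
    rw [← h.tsum_eq, ENNReal.ofReal_tsum_of_nonneg
      (fun k => div_nonneg (hnn _ _) (by positivity)) h.summable]
    refine tsum_congr fun k => ?_
    rw [← ENNReal.ofReal_mul (div_nonneg (hnn _ _) (by positivity)), mul_pow]
    congr 1
    ring
  simp only [hpt]
  rw [lintegral_tsum (fun k => by fun_prop)]
  exact tsum_congr fun k => lintegral_const_mul _ (by fun_prop)

/-- An exponential moment passes to any measure with smaller even moments. -/
theorem HasExpMoment.of_even_moments_le {μ ν : Measure ℝ} (hμ : HasExpMoment μ)
    (h : ∀ k : ℕ, ∫⁻ x, ENNReal.ofReal (x ^ (2 * k)) ∂ν ≤ ∫⁻ x, ENNReal.ofReal (x ^ (2 * k)) ∂μ) :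
    HasExpMoment ν := by
  obtain ⟨δ, hδ, hi⟩ := hμ
  refine ⟨δ, hδ, ?_⟩
  have habs : ∀ x : ℝ, |δ * x| = δ * |x| := fun x => by rw [abs_mul, abs_of_pos hδ]
  -- `cosh (δ x)` and `exp (δ |x|)` are comparable up to a factor `2`, so integrability of either
  -- gives that of the other.
  have hle : ∀ x : ℝ, Real.cosh (δ * x) ≤ Real.exp (δ * |x|) := by
    intro x
    rw [← Real.cosh_abs, habs, Real.cosh_eq]
    have : Real.exp (-(δ * |x|)) ≤ Real.exp (δ * |x|) :=
      Real.exp_le_exp.2 (neg_le_self (by positivity))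
    linarith
  have hge : ∀ x : ℝ, Real.exp (δ * |x|) ≤ 2 * Real.cosh (δ * x) := by
    intro x
    rw [← Real.cosh_abs (δ * x), habs, Real.cosh_eq]
    have := Real.exp_pos (-(δ * |x|))
    linarith
  have hμc : Integrable (fun x : ℝ => Real.cosh (δ * x)) μ :=
    hi.mono' (by fun_prop) (Eventually.of_forall fun x => by
      rw [Real.norm_eq_abs, abs_of_pos (Real.cosh_pos _)]; exact hle x)
  have hνc : Integrable (fun x : ℝ => Real.cosh (δ * x)) ν := by
    refine ⟨by fun_prop, ?_⟩
    rw [hasFiniteIntegral_iff_ofReal (Eventually.of_forall fun x => (Real.cosh_pos _).le)]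
    refine lt_of_le_of_lt ?_ ((hasFiniteIntegral_iff_ofReal
      (Eventually.of_forall fun x => (Real.cosh_pos _).le)).1 hμc.2)
    rw [lintegral_ofReal_cosh, lintegral_ofReal_cosh]
    exact ENNReal.tsum_le_tsum fun k => mul_le_mul_right (h k) _
  exact (hνc.const_mul 2).mono' (by fun_prop) (Eventually.of_forall fun x => by
      rw [Real.norm_eq_abs, Real.abs_exp]; exact hge x)

/-! ### Orthogonal polynomials and connection coefficients. -/

theorem integrable_polynomial_eval {ν : Measure ℝ}
    (hν : ∀ k : ℕ, Integrable (fun x : ℝ => x ^ k) ν) (q : ℝ[X]) :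
    Integrable (fun x : ℝ => q.eval x) ν := by
  simp only [eval_eq_sum_range]
  exact integrable_finsetSum _ fun i _ => (hν i).const_mul _

theorem memLp_polynomial_eval {ν : Measure ℝ}
    (hν : ∀ k : ℕ, Integrable (fun x : ℝ => x ^ k) ν) (q : ℝ[X]) :
    MemLp (fun x : ℝ => q.eval x) 2 ν := by
  rw [memLp_two_iff_integrable_sq q.continuous.aestronglyMeasurable]
  exact (integrable_polynomial_eval hν (q ^ 2)).congr (Eventually.of_forall fun x => eval_pow 2)

/-- The linear map sending a polynomial to its class in `L²(ν)`. -/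
noncomputable def polynomialToL2 (ν : Measure ℝ)
    (hν : ∀ k : ℕ, Integrable (fun x : ℝ => x ^ k) ν) : ℝ[X] →ₗ[ℝ] Lp ℝ 2 ν where
  toFun q := (memLp_polynomial_eval hν q).toLp
  map_add' q s := by
    rw [← MemLp.toLp_add, MemLp.toLp_eq_toLp_iff]
    exact Eventually.of_forall fun x => by simp
  map_smul' a q := by
    rw [RingHom.id_apply, ← MemLp.toLp_const_smul, MemLp.toLp_eq_toLp_iff]
    exact Eventually.of_forall fun x => by simp

theorem inner_polynomialToL2_toLp {ν : Measure ℝ}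
    (hν : ∀ k : ℕ, Integrable (fun x : ℝ => x ^ k) ν) (q : ℝ[X]) {f : ℝ → ℝ} (hf : MemLp f 2 ν) :
    inner ℝ (polynomialToL2 ν hν q) hf.toLp = ∫ x, q.eval x * f x ∂ν := by
  rw [L2.inner_def]
  refine integral_congr_ae ?_
  filter_upwards [(memLp_polynomial_eval hν q).coeFn_toLp, hf.coeFn_toLp] with x h1 h2
  change inner ℝ ((memLp_polynomial_eval hν q).toLp _ x) _ = _
  rw [h1, h2, real_inner_eq_re_inner, RCLike.inner_apply']
  simp

theorem inner_polynomialToL2 {ν : Measure ℝ}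
    (hν : ∀ k : ℕ, Integrable (fun x : ℝ => x ^ k) ν) (q s : ℝ[X]) :
    inner ℝ (polynomialToL2 ν hν q) (polynomialToL2 ν hν s) = ∫ x, q.eval x * s.eval x ∂ν :=
  inner_polynomialToL2_toLp hν q (memLp_polynomial_eval hν s)

/-- Orthogonal projection onto the polynomials of degree `< n`, which also works when the
`L²` seminorm on polynomials is degenerate. -/
theorem exists_degree_eq_orthogonal {ν : Measure ℝ}
    (hν : ∀ k : ℕ, Integrable (fun x : ℝ => x ^ k) ν) (n : ℕ) :
    ∃ r : ℝ[X], r.degree = (n : WithBot ℕ) ∧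
      ∀ q : ℝ[X], q.degree < (n : WithBot ℕ) → ∫ x, r.eval x * q.eval x ∂ν = 0 := by
  set T := polynomialToL2 ν hν
  set K : Submodule ℝ (Lp ℝ 2 ν) := (degreeLT ℝ n).map T
  obtain ⟨w, hw, hor⟩ := Submodule.HasOrthogonalProjection.exists_orthogonal (K := K) (T (X ^ n))
  obtain ⟨s, hs, rfl⟩ := hw
  have hs' : s.degree < (n : WithBot ℕ) := mem_degreeLT.1 hs
  refine ⟨X ^ n - s, ?_, fun q hq => ?_⟩
  · rw [degree_sub_eq_left_of_degree_lt (by rwa [degree_X_pow]), degree_X_pow]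
  · rw [← inner_polynomialToL2 hν, map_sub]
    exact (Submodule.mem_orthogonal' K _).1 hor _ ⟨q, mem_degreeLT.2 hq, rfl⟩

theorem exists_isOrthogonalPolynomials {ν : Measure ℝ} [IsFiniteMeasure ν] (h0 : ν ≠ 0)
    (hν : ∀ k : ℕ, Integrable (fun x : ℝ => x ^ k) ν) :
    ∃ r : ℕ → ℝ[X], IsOrthogonalPolynomials ν r ∧ ∫ x, (r 0).eval x ∂ν = 1 := by
  choose r hdeg hor using exists_degree_eq_orthogonal hν
  obtain ⟨a, ha⟩ : ∃ a, r 0 = C a := ⟨_, eq_C_of_degree_eq_zero (by simpa using hdeg 0)⟩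
  have ha0 : a ≠ 0 := by
    rintro rfl
    simpa [ha] using hdeg 0
  have hm : ν.real Set.univ ≠ 0 := by simpa [measureReal_def, ENNReal.toReal_eq_zero_iff] using h0
  -- One common rescaling of all `r n`, chosen so that the constant `b * a` has integral `1`.
  set b : ℝ := (ν.real Set.univ * a)⁻¹
  have hb : b ≠ 0 := inv_ne_zero (mul_ne_zero hm ha0)
  have hlt : ∀ m n : ℕ, n < m → ∫ x, (C b * r m).eval x * (C b * r n).eval x ∂ν = 0 := by
    intro m n hmn
    have : ∀ x, (C b * r m).eval x * (C b * r n).eval x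
        = b ^ 2 * ((r m).eval x * (r n).eval x) := fun x => by simp; ring
    simp only [this, integral_const_mul]
    rw [hor m (r n) (by rw [hdeg]; exact_mod_cast hmn), mul_zero]
  refine ⟨fun n => C b * r n, ⟨hν, fun n => ?_, fun m n hmn => ?_⟩, ?_⟩
  · rw [degree_C_mul hb, hdeg]
  · rcases lt_or_gt_of_ne hmn with h | h
    · simp only [mul_comm (eval _ (C b * r m))]
      exact hlt n m h
    · exact hlt m n h
  · simp only [ha, eval_mul, eval_C, integral_const, smul_eq_mul]
    simp only [b]
    field_simp

theorem exists_isConnection {p r : ℕ → ℝ[X]} (hp : ∀ n : ℕ, (p n).degree = (n : WithBot ℕ))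
    (hr : ∀ n : ℕ, (r n).degree = (n : WithBot ℕ)) : ∃ γ : ℕ → ℕ → ℝ, IsConnection p r γ := by
  let S : Polynomial.Sequence ℝ := ⟨r, hr⟩
  have key : ∀ n : ℕ, ∃ g : ℕ → ℝ, p n = ∑ j ∈ Finset.range (n + 1), C (g j) * r j := by
    intro n
    have hmem : p n ∈ Submodule.span ℝ (r '' ((Finset.range (n + 1) : Finset ℕ) : Set ℕ)) := by
      have := S.span_degreeLT (m := n + 1) fun i _ =>
        isUnit_iff_ne_zero.2 (leadingCoeff_ne_zero.2 (S.ne_zero i))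
      rw [Finset.coe_range]
      change p n ∈ Submodule.span ℝ (S '' _)
      rw [this, mem_degreeLT, hp]
      exact_mod_cast n.lt_succ_self
    obtain ⟨g, hg⟩ := (Submodule.mem_span_image_finset_iff_exists_fun ℝ).1 hmem
    refine ⟨fun j => if h : j ∈ Finset.range (n + 1) then g ⟨j, h⟩ else 0, ?_⟩
    rw [← hg, ← Finset.sum_coe_sort (Finset.range (n + 1))]
    refine Finset.sum_congr rfl fun j _ => ?_
    simp only [dif_pos j.2, smul_eq_C_mul]
  choose γ hγ using key
  exact ⟨γ, hγ⟩

/-- As `r 0` is a nonzero constant, orthogonality to it makes the integral of every later `r j`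
vanish. -/
theorem integral_eval_of_isConnection {ν : Measure ℝ} {p r : ℕ → ℝ[X]} {γ : ℕ → ℕ → ℝ}
    (hr : IsOrthogonalPolynomials ν r) (h1 : ∫ x, (r 0).eval x ∂ν = 1) (h : IsConnection p r γ)
    (n : ℕ) : ∫ x, (p n).eval x ∂ν = γ n 0 := by
  obtain ⟨a, ha⟩ : ∃ a, r 0 = C a := ⟨_, eq_C_of_degree_eq_zero (by simpa using hr.degree_eq 0)⟩
  have ha0 : a ≠ 0 := by
    rintro rfl
    simpa [ha] using hr.degree_eq 0
  have hz : ∀ j : ℕ, j ≠ 0 → ∫ x, (r j).eval x ∂ν = 0 := by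
    intro j hj
    have := hr.orthogonal j 0 hj
    simp only [ha, eval_C, integral_mul_const] at this
    exact (mul_eq_zero.1 this).resolve_right ha0
  have hint := integrable_polynomial_eval hr.moments
  rw [h n]
  simp only [eval_finsetSum, eval_mul, eval_C]
  rw [integral_finsetSum _ fun j _ => (hint (r j)).const_mul _,
    Finset.sum_eq_single_of_mem 0 (by simp) fun j _ hj => by rw [integral_const_mul, hz j hj, mul_zero],
    integral_const_mul, h1, mul_one]

theorem Summable.of_mul_log_sq {a : ℕ → ℝ} (ha : ∀ n, 0 ≤ a n)
    (h : Summable fun n : ℕ => a n * Real.log ((n : ℝ) + 1) ^ 2) : Summable a := by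
  -- The weight is `log 1 = 0` at `n = 0`, so that term is dropped; afterwards the weight is at
  -- least `log 2 ^ 2`.
  rw [← summable_nat_add_iff 1] at h ⊢
  have h2 : 0 < Real.log 2 := Real.log_pos one_lt_two
  refine Summable.of_nonneg_of_le (fun n => ha _) (fun n => ?_) (h.mul_right ((Real.log 2 ^ 2)⁻¹))
  rw [mul_assoc]
  refine le_mul_of_one_le_right (ha _) ?_
  rw [← div_eq_mul_inv, one_le_div (by positivity)]
  gcongr
  push_cast
  linarith [n.cast_nonneg (α := ℝ)]

/-! ### Mean-square convergence of the orthogonal series. -/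

section Series

variable {μ : Measure ℝ} {p : ℕ → ℝ[X]} {c : ℕ → ℝ} {f : ℝ → ℝ}

theorem hasMeanSquareSum_iff (hp : IsOrthogonalPolynomials μ p) (hf : MemLp f 2 μ) :
    HasMeanSquareSum μ p c f ↔
      Tendsto (fun N => ∑ n ∈ Finset.range N, c n • polynomialToL2 μ hp.moments (p n)) atTop
        (𝓝 hf.toLp) := by
  have h : ∀ N, ∑ n ∈ Finset.range N, c n • polynomialToL2 μ hp.moments (p n) =
      (memLp_polynomial_eval hp.moments (∑ n ∈ Finset.range N, c n • p n)).toLp := by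
    intro N
    simp only [← map_smul, ← map_sum]
    rfl
  simp only [h]
  rw [Lp.tendsto_Lp_iff_tendsto_eLpNorm'']
  simp [HasMeanSquareSum, hf, eval_finsetSum, Pi.sub_def]

theorem exists_hasMeanSquareSum (hp : IsOrthogonalPolynomials μ p)
    (hp0 : ∀ n : ℕ, hatNorm μ p n ≠ 0) (hc : Summable fun n => c n ^ 2 * hatNorm μ p n) :
    ∃ f : ℝ → ℝ, HasMeanSquareSum μ p c f := by
  set v : ℕ → Lp ℝ 2 μ := fun n => polynomialToL2 μ hp.moments (p n)
  have hnorm : ∀ n, ‖v n‖ ^ 2 = hatNorm μ p n := by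
    intro n
    rw [← real_inner_self_eq_norm_sq, inner_polynomialToL2]
    simp only [hatNorm, sq]
  have hv : ∀ n, ‖v n‖ ≠ 0 := fun n h => hp0 n (by rw [← hnorm, h]; simp)
  -- Riesz–Fischer for the normalized vectors, with coefficients `c n * ‖v n‖`.
  have he : Orthonormal ℝ fun n => ‖v n‖⁻¹ • v n := by
    refine ⟨fun n => ?_, fun m n hmn => ?_⟩
    · rw [norm_smul, norm_inv, norm_norm, inv_mul_cancel₀ (hv n)]
    · change inner ℝ (‖v m‖⁻¹ • v m) (‖v n‖⁻¹ • v n) = 0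
      rw [real_inner_smul_left, real_inner_smul_right, inner_polynomialToL2,
        hp.orthogonal m n hmn, mul_zero, mul_zero]
  have hs := (he.orthogonalFamily.summable_iff_norm_sq_summable fun n => c n * ‖v n‖).2 (by
    refine hc.congr fun n => ?_
    rw [← hnorm, Real.norm_eq_abs, sq_abs, mul_pow])
  have hs' : Summable fun n => c n • v n := by
    refine hs.congr fun n => ?_
    rw [LinearIsometry.toSpanSingleton_apply, smul_smul, mul_assoc, mul_inv_cancel₀ (hv n), mul_one]
  refine ⟨_, (hasMeanSquareSum_iff hp (Lp.memLp (∑' n, c n • v n))).2 ?_⟩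
  rw [Lp.toLp_coeFn]
  exact hs'.hasSum.tendsto_sum_nat

/-- The coefficients of a mean-square convergent orthogonal series are its Fourier coefficients. -/
theorem HasMeanSquareSum.integral_mul_eq (hp : IsOrthogonalPolynomials μ p)
    (h : HasMeanSquareSum μ p c f) (n : ℕ) :
    ∫ x, (p n).eval x * f x ∂μ = c n * hatNorm μ p n := by
  have ht := (hasMeanSquareSum_iff hp h.1).1 h
  have h1 := (tendsto_const_nhds (x := polynomialToL2 μ hp.moments (p n))).inner (𝕜 := ℝ) ht
  rw [inner_polynomialToL2_toLp] at h1
  -- Pairing with `p n` gives the same value for all partial sums with `N > n`.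
  refine tendsto_nhds_unique h1 (tendsto_const_nhds.congr' ?_)
  filter_upwards [eventually_gt_atTop n] with N hN
  rw [inner_sum, Finset.sum_eq_single_of_mem n (Finset.mem_range.2 hN)]
  · rw [real_inner_smul_right, inner_polynomialToL2]
    simp only [hatNorm, sq]
  · intro m _ hm
    rw [real_inner_smul_right, inner_polynomialToL2, hp.orthogonal n m hm.symm, mul_zero]

end Series

/-- One polynomial of each degree spans everything, so linear properties need checking only on the
`p n`. -/
theorem forall_polynomial_of_degree_eq {p : ℕ → ℝ[X]}
    (hp : ∀ n : ℕ, (p n).degree = (n : WithBot ℕ)) {P : ℝ[X] → Prop} (h : ∀ n, P (p n))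
    (hadd : ∀ q s, P q → P s → P (q + s)) (hsmul : ∀ (a : ℝ) q, P q → P (a • q)) (q : ℝ[X]) :
    P q := by
  let S : Polynomial.Sequence ℝ := ⟨p, hp⟩
  have hspan := S.span fun i => isUnit_iff_ne_zero.2 (leadingCoeff_ne_zero.2 (S.ne_zero i))
  have hq : q ∈ Submodule.span ℝ (Set.range S) := hspan ▸ Submodule.mem_top
  induction hq using Submodule.span_induction with
  | mem x hx => obtain ⟨n, rfl⟩ := hx; exact h n
  | zero => simpa using hsmul 0 _ (h 0)
  | add x y _ _ hx hy => exact hadd x y hx hy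
  | smul a x _ hx => exact hsmul a x hx

/-! ### Densities and equality of moments. -/

theorem integral_withDensity_ofReal {α : Type*} [MeasurableSpace α] {μ : Measure α} {g : α → ℝ}
    (hg : AEMeasurable g μ) (φ : α → ℝ) :
    ∫ x, φ x ∂(μ.withDensity fun x => ENNReal.ofReal (g x)) = ∫ x, φ x * max (g x) 0 ∂μ := by
  rw [integral_withDensity_eq_integral_toReal_smul₀ hg.ennreal_ofReal (by simp)]
  simp only [ENNReal.toReal_ofReal', smul_eq_mul, mul_comm]

namespace IsRadonNikodymDeriv

variable {f : ℝ → ℝ} {ν μ : Measure ℝ} [IsFiniteMeasure ν] [IsFiniteMeasure μ]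

theorem integrable_iff (h : IsRadonNikodymDeriv f ν μ) (φ : ℝ → ℝ) :
    Integrable φ ν ↔ Integrable (fun x => φ x * f x) μ := by
  rw [← integrable_rnDeriv_smul_iff h.1]
  refine integrable_congr ?_
  filter_upwards [h.2] with x hx
  rw [hx, smul_eq_mul, mul_comm]

theorem integral_eq (h : IsRadonNikodymDeriv f ν μ) (φ : ℝ → ℝ) :
    ∫ x, φ x ∂ν = ∫ x, φ x * f x ∂μ := by
  rw [← integral_rnDeriv_smul h.1]
  refine integral_congr_ae ?_
  filter_upwards [h.2] with x hx
  rw [hx, smul_eq_mul, mul_comm]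

end IsRadonNikodymDeriv

theorem isRadonNikodymDeriv_withDensity {f : ℝ → ℝ} {μ : Measure ℝ} [SigmaFinite μ]
    (hf : AEMeasurable f μ) (h0 : ∀ᵐ x ∂μ, 0 ≤ f x) :
    IsRadonNikodymDeriv f (μ.withDensity fun x => ENNReal.ofReal (f x)) μ := by
  refine ⟨withDensity_absolutelyContinuous _ _, ?_⟩
  filter_upwards [Measure.rnDeriv_withDensity₀ μ hf.ennreal_ofReal, h0] with x hx h0
  rw [hx, ENNReal.toReal_ofReal h0]

/-- This is `ν = f μ` written without signed measures. Domination of `ν` by `f⁺ μ` gives absolute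
continuity, and additivity of densities gives `dν/dμ = f⁺ - f⁻`. -/
theorem isRadonNikodymDeriv_of_add_withDensity_eq {f : ℝ → ℝ} {ν μ : Measure ℝ}
    [IsFiniteMeasure ν] [IsFiniteMeasure μ] (hf : Integrable f μ)
    (h : ν + μ.withDensity (fun x => ENNReal.ofReal (-f x))
      = μ.withDensity fun x => ENNReal.ofReal (f x)) : IsRadonNikodymDeriv f ν μ := by
  have hac : ν ≪ μ :=
    (Measure.le_add_right le_rfl).absolutelyContinuous.trans
      (h ▸ withDensity_absolutelyContinuous μ _)
  refine ⟨hac, ?_⟩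
  have := isFiniteMeasure_withDensity_ofReal hf.neg.2
  have hadd := Measure.rnDeriv_add' ν (μ.withDensity fun x => ENNReal.ofReal (-f x)) μ
  rw [h] at hadd
  have hfm := hf.aemeasurable
  filter_upwards [hadd, Measure.rnDeriv_withDensity₀ μ hfm.ennreal_ofReal,
    Measure.rnDeriv_withDensity₀ μ hfm.neg.ennreal_ofReal, Measure.rnDeriv_lt_top ν μ]
    with x h1 h2 h3 h4
  simp only [Pi.neg_apply] at h3
  rw [h2, Pi.add_apply, h3] at h1
  have h5 := congrArg ENNReal.toReal h1
  rw [ENNReal.toReal_add h4.ne ENNReal.ofReal_ne_top, ENNReal.toReal_ofReal',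
    ENNReal.toReal_ofReal'] at h5
  have := max_zero_sub_max_neg_zero_eq_self (f x)
  linarith

/-- Under an exponential moment condition on `μ`, an `L²(μ)` function is the density of a finite
measure `ν` as soon as it has the same moments. -/
theorem HasExpMoment.isRadonNikodymDeriv_iff {f : ℝ → ℝ} {ν μ : Measure ℝ} [IsFiniteMeasure ν]
    (hμ : HasExpMoment μ) (hf : MemLp f 2 μ) :
    IsRadonNikodymDeriv f ν μ ↔ ∀ q : ℝ[X], Integrable (fun x : ℝ => q.eval x) ν ∧
      ∫ x, q.eval x ∂ν = ∫ x, q.eval x * f x ∂μ := by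
  have := hμ.isFiniteMeasure
  have hmul : ∀ (q : ℝ[X]) {g : ℝ → ℝ}, MemLp g 2 μ → Integrable (fun x => q.eval x * g x) μ :=
    fun q g hg => (memLp_polynomial_eval hμ.integrable_pow q).integrable_mul hg
  refine ⟨fun h q => ⟨(h.integrable_iff _).2 (hmul q hf), h.integral_eq _⟩, fun h => ?_⟩
  have hmom : ∀ k : ℕ, Integrable (fun x : ℝ => x ^ k) ν := fun k => by
    simpa using (h (X ^ k)).1
  have hev : ∀ (k : ℕ) (x : ℝ), 0 ≤ x ^ (2 * k) := fun k x => by rw [pow_mul]; positivity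
  have habs := hμ.withDensity_ofReal hf.abs
  -- Even powers are nonnegative, so `∫ x^(2k) dν = ∫ x^(2k) f dμ ≤ ∫ x^(2k) |f| dμ`.
  have hν : HasExpMoment ν := by
    refine habs.of_even_moments_le fun k => ?_
    rw [← ofReal_integral_eq_lintegral_ofReal (hmom _) (Eventually.of_forall (hev k)),
      ← ofReal_integral_eq_lintegral_ofReal (habs.integrable_pow _) (Eventually.of_forall (hev k)),
      integral_withDensity_ofReal hf.abs.aestronglyMeasurable.aemeasurable]
    refine ENNReal.ofReal_le_ofReal ?_
    have h1 := (h (X ^ (2 * k))).2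
    have h2 := hmul (X ^ (2 * k)) hf
    have h3 := hmul (X ^ (2 * k)) hf.abs
    simp only [eval_pow, eval_X] at h1 h2 h3
    rw [h1]
    simp only [Pi.abs_apply, abs_nonneg, max_eq_left] at h3 ⊢
    exact integral_mono h2 h3 fun x => mul_le_mul_of_nonneg_left (le_abs_self _) (hev k x)
  have hfm := hf.aestronglyMeasurable.aemeasurable
  have hpos := hμ.withDensity_ofReal hf
  have hneg := hμ.withDensity_ofReal hf.neg
  simp only [Pi.neg_apply] at hneg
  refine isRadonNikodymDeriv_of_add_withDensity_eq (hf.integrable one_le_two)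
    ((hν.add hneg).ext hpos fun k => ?_)
  rw [integral_add_measure (hmom k) (hneg.integrable_pow k), integral_withDensity_ofReal hfm,
    integral_withDensity_ofReal (g := fun x => -f x) hfm.neg]
  have h1 := (h (X ^ k)).2
  have h2 := hmul (X ^ k) hf
  have h3 := hmul (X ^ k) hf.neg_part
  simp only [eval_pow, eval_X] at h1 h2 h3
  rw [h1, ← integral_add h2 h3]
  refine integral_congr_ae (Eventually.of_forall fun x => ?_)
  have := max_zero_sub_max_neg_zero_eq_self (f x)
  beta_reduce
  rw [← mul_add]
  congr 1
  linarith

/-! ### The main theorem. -/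

theorem theorem1 (μ : Measure ℝ) (hμ : HasExpMoment μ)
    (M : Set ℝ) (hM : IsClosed M) (hMμ : M ⊆ μ.support)
    (p : ℕ → ℝ[X]) (hp : IsOrthogonalPolynomials μ p) (hp0 : ∀ n : ℕ, hatNorm μ p n ≠ 0)
    (c : ℕ → ℝ)
    (hRM : Summable fun n : ℕ => c n ^ 2 * hatNorm μ p n * Real.log ((n : ℝ) + 1) ^ 2) :
    -- the series converges in mean square
    (∃ f : ℝ → ℝ, HasMeanSquareSum μ p c f) ∧
    ∀ f : ℝ → ℝ, HasMeanSquareSum μ p c f →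
      -- the sum is nonnegative and supported on `M` iff it is `dν/dμ` for some positive `ν` on `M`
      (((∀ᵐ x ∂μ, 0 ≤ f x) ∧ (∀ᵐ x ∂μ, x ∉ M → f x = 0)) ↔
        ∃ ν : Measure ℝ, IsFiniteMeasure ν ∧ ν Mᶜ = 0 ∧ IsRadonNikodymDeriv f ν μ) ∧
      ∀ ν : Measure ℝ, IsFiniteMeasure ν → ν Mᶜ = 0 →
        -- `f = dν/dμ` iff the coefficients are given by the integrals of `pₙ` against `ν`
        (IsRadonNikodymDeriv f ν μ ↔
          ∀ n : ℕ, Integrable (fun x : ℝ => (p n).eval x) ν ∧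
            c n = (∫ x in M, (p n).eval x ∂ν) / hatNorm μ p n) ∧
        -- the same through the free connection coefficients
        (∀ (r : ℕ → ℝ[X]) (γ : ℕ → ℕ → ℝ),
          IsOrthogonalPolynomials ν r → ∫ x, (r 0).eval x ∂ν = 1 → IsConnection p r γ →
            (IsRadonNikodymDeriv f ν μ ↔ ∀ n : ℕ, c n = γ n 0 / hatNorm μ p n)) ∧
        -- such orthogonal polynomials and connection coefficients exist, unless `ν = 0`
        (IsRadonNikodymDeriv f ν μ → ν ≠ 0 →
          ∃ (r : ℕ → ℝ[X]) (γ : ℕ → ℕ → ℝ),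
            IsOrthogonalPolynomials ν r ∧ ∫ x, (r 0).eval x ∂ν = 1 ∧ IsConnection p r γ) := by
  have := hμ.isFiniteMeasure
  refine ⟨exists_hasMeanSquareSum hp hp0 (Summable.of_mul_log_sq (fun n => ?_) hRM), ?_⟩
  · exact mul_nonneg (sq_nonneg _) (integral_nonneg fun x => sq_nonneg _)
  intro f hfsum
  have hf := hfsum.1
  have hfm := hf.aestronglyMeasurable.aemeasurable
  refine ⟨⟨fun ⟨hnn, hoff⟩ => ?_, ?_⟩, ?_⟩
  · refine ⟨_, isFiniteMeasure_withDensity_ofReal (hf.integrable one_le_two).2, ?_,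
      isRadonNikodymDeriv_withDensity hfm hnn⟩
    rw [withDensity_apply _ hM.measurableSet.compl, setLIntegral_eq_zero_iff' hM.measurableSet.compl
      hfm.ennreal_ofReal.restrict]
    filter_upwards [hoff] with x hx hxM
    simp [hx hxM]
  · rintro ⟨ν, hν, hνM, hac, hfν⟩
    refine ⟨hfν.mono fun x hx => hx ▸ ENNReal.toReal_nonneg, ?_⟩
    rw [← Measure.withDensity_rnDeriv_eq ν μ hac, withDensity_apply _ hM.measurableSet.compl,
      setLIntegral_eq_zero_iff hM.measurableSet.compl (Measure.measurable_rnDeriv _ _)] at hνM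
    filter_upwards [hfν, hνM] with x h1 h2 hx
    rw [h1, h2 hx, ENNReal.toReal_zero]
  intro ν hν hνM
  -- Integrals are over the whole line here; since `ν` is carried by `M`, restricting to `M` changes
  -- nothing.
  have hcoef : IsRadonNikodymDeriv f ν μ ↔ ∀ n : ℕ, Integrable (fun x : ℝ => (p n).eval x) ν ∧
      c n = (∫ x, (p n).eval x ∂ν) / hatNorm μ p n := by
    rw [hμ.isRadonNikodymDeriv_iff hf]
    refine ⟨fun h n => ⟨(h _).1, ?_⟩, fun h => ?_⟩
    · rw [(h _).2, hfsum.integral_mul_eq hp, mul_div_cancel_right₀ _ (hp0 n)]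
    · have hmul : ∀ q : ℝ[X], Integrable (fun x => q.eval x * f x) μ :=
        fun q => (memLp_polynomial_eval hμ.integrable_pow q).integrable_mul hf
      refine forall_polynomial_of_degree_eq hp.degree_eq (fun n => ⟨(h n).1, ?_⟩) ?_ ?_
      · rw [hfsum.integral_mul_eq hp, (h n).2, div_mul_cancel₀ _ (hp0 n)]
      · rintro q s ⟨hq, hq'⟩ ⟨hs, hs'⟩
        simp only [eval_add, add_mul]
        exact ⟨hq.add hs, by rw [integral_add hq hs, integral_add (hmul q) (hmul s), hq', hs']⟩
      · rintro a q ⟨hq, hq'⟩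
        simp only [eval_smul, smul_eq_mul, mul_assoc]
        exact ⟨hq.const_mul a, by rw [integral_const_mul, integral_const_mul, hq']⟩
  have hrestrict : ν.restrict M = ν := Measure.restrict_eq_self_of_ae_mem hνM
  refine ⟨by rwa [hrestrict], fun r γ hr h1 hγ => ?_, fun h h0 => ?_⟩
  · rw [hcoef]
    refine forall_congr' fun n => ?_
    rw [integral_eval_of_isConnection hr h1 hγ,
      and_iff_right (integrable_polynomial_eval hr.moments (p n))]
  · obtain ⟨r, hr, h1⟩ := exists_isOrthogonalPolynomials h0 fun k => by
      simpa using (((hμ.isRadonNikodymDeriv_iff hf).1 h) (X ^ k)).1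
    obtain ⟨γ, hγ⟩ := exists_isConnection hp.degree_eq hr.degree_eq
    exact ⟨r, γ, hr, h1, hγ⟩
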